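/- Let $n\ge 0$, let $U\subseteq\mathbb{R}^n$ be open, and let $L=(L^i_j(u))$ be a real analytic field of $n\times n$ real matrices on $U$ that is a Nijenhuis operator, i.e. for all smooth vector fields $\xi,\eta$ on $U$ $$L^2[\xi,\eta]-L[L\xi,\eta]-L[\xi,L\eta]+[L\xi,L\eta]=0 .$$ For a real $n\times n$ matrix $A$ define $f_1(A),\dots,f_n(A)$ by $\det(\lambda\,\mathrm{Id}-A)=\lambda^n-f_1(A)\lambda^{n-1}-\dots-f_n(A)$, and call $A$ $\mathrm{gl}$-regular if $\mathrm{Id},A,\dots,A^{n-1}$ are linearly independent. Let $u_0$ be an $\mathbb{R}^n$-valued function, real analytic near $0\in\mathbb{R}$, with $u_0(0)\in U$, and put $v_i(x)=f_i(L(u_0(x)))$ for $x$ near $0$. For commuting matrices $A,M$ put $$r(A,M)=A^n-v_1(M)A^{n-1}-\dots-v_{n-1}(M)A-v_n(M),$$ where $v_i(M)$ is obtained by substituting $M$ into the Taylor series of $v_i$ at $0$. Then there are functions $f_1(t,x),\dots,f_n(t,x)$, real analytic near $(0,0)$, with the following properties. 1. The relation $r(A,tA+x\,\mathrm{Id})=0$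 determines the $f_i(t,x)$ uniquely as the characteristic coefficients of $A$: for every $R$ there is a neighbourhood of $(0,0)$ such that for all $(t,x)$ in it and all $\mathrm{gl}$-regular real $n\times n$ matrices $A$ with $|f_i(A)|\le R$ for all $i$, the Taylor series of all $v_i$ converge at $tA+x\,\mathrm{Id}$, and $$r(A,\,tA+x\,\mathrm{Id})=0\iff f_i(A)=f_i(t,x)\ \text{ for } i=1,\dots,n .$$ 2. If $u(t,x)$ is the real analytic solution near $(0,0)$ of the system $u_t=L(u)u_x$ with $u(0,x)=u_0(x)$, then $f_i(L(u(t,x)))=f_i(t,x)$ for $i=1,\dots,n$ and all $(t,x)$ near $(0,0)$. -/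

import Mathlib

open Filter Topology
open scoped ContDiff

noncomputable section

/-- The Nijenhuis torsion of the operator field `L` on `ℝⁿ`, applied to the vector fields
`ξ` and `η`, at the point `u`:
`L²[ξ, η] - L[Lξ, η] - L[ξ, Lη] + [Lξ, Lη]`. -/
def nijenhuisTorsion {n : ℕ} (L : (Fin n → ℝ) → Matrix (Fin n) (Fin n) ℝ)
    (ξ η : (Fin n → ℝ) → (Fin n → ℝ)) (u : Fin n → ℝ) : Fin n → ℝ :=
  (L u ^ 2).mulVec (VectorField.lieBracket ℝ ξ η u)
    - (L u).mulVec (VectorField.lieBracket ℝ (fun w => (L w).mulVec (ξ w)) η u)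
    - (L u).mulVec (VectorField.lieBracket ℝ ξ (fun w => (L w).mulVec (η w)) u)
    + VectorField.lieBracket ℝ (fun w => (L w).mulVec (ξ w)) (fun w => (L w).mulVec (η w)) u

/-- `L` is a Nijenhuis operator on the (open) set `U`: its torsion vanishes on all smooth
vector fields. -/
def IsNijenhuisOn {n : ℕ} (L : (Fin n → ℝ) → Matrix (Fin n) (Fin n) ℝ)
    (U : Set (Fin n → ℝ)) : Prop :=
  ∀ ξ η : (Fin n → ℝ) → (Fin n → ℝ), ContDiffOn ℝ ∞ ξ U → ContDiffOn ℝ ∞ η U →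
    ∀ u ∈ U, nijenhuisTorsion L ξ η u = 0

/-- The matrix `A` is `gl`-regular: `Id, A, …, Aⁿ⁻¹` are linearly independent. -/
def IsGlRegular {n : ℕ} (A : Matrix (Fin n) (Fin n) ℝ) : Prop :=
  LinearIndependent ℝ (fun k : Fin n => A ^ (k : ℕ))

/-- The coefficients `f₁, …, fₙ` of the characteristic polynomial
`det (λ Id - A) = λⁿ - f₁ λⁿ⁻¹ - … - fₙ`; the index `i : Fin n` stands for `fᵢ₊₁`. -/
def charCoeff {n : ℕ} (A : Matrix (Fin n) (Fin n) ℝ) (i : Fin n) : ℝ :=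
  -(A.charpoly.coeff (n - 1 - (i : ℕ)))

/-- The `k`-th term of the Taylor series at `0` of the function `v`, evaluated at a matrix. -/
def taylorTerm {n : ℕ} (v : ℝ → ℝ) (M : Matrix (Fin n) (Fin n) ℝ) (k : ℕ) :
    Matrix (Fin n) (Fin n) ℝ :=
  (iteratedDeriv k v 0 / (Nat.factorial k : ℝ)) • M ^ k

/-- The analytic matrix function `v(M)`, meaningful when the Taylor series converges at `M`. -/
def matrixFun {n : ℕ} (v : ℝ → ℝ) (M : Matrix (Fin n) (Fin n) ℝ) :
    Matrix (Fin n) (Fin n) ℝ :=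
  ∑' k : ℕ, taylorTerm v M k

/-- `r(A, M) = Aⁿ - v₁(M) Aⁿ⁻¹ - … - vₙ₋₁(M) A - vₙ(M)`; the index `i : Fin n` stands for
`vᵢ₊₁`. -/
def rMatrix {n : ℕ} (v : Fin n → ℝ → ℝ) (A M : Matrix (Fin n) (Fin n) ℝ) :
    Matrix (Fin n) (Fin n) ℝ :=
  A ^ n - ∑ i : Fin n, matrixFun (v i) M * A ^ (n - 1 - (i : ℕ))

/-- `M = t A + x Id` for `p = (t, x)`. -/
def pencil {n : ℕ} (p : ℝ × ℝ) (A : Matrix (Fin n) (Fin n) ℝ) : Matrix (Fin n) (Fin n) ℝ :=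
  p.1 • A + p.2 • (1 : Matrix (Fin n) (Fin n) ℝ)

/-- `u = u(t, x)` is a real analytic solution near `(t, x) = (0, 0)` of `u_t = L(u) u_x` with
`u(0, x) = u₀(x)`. -/
structure IsLocalSolution {n : ℕ} (L : (Fin n → ℝ) → Matrix (Fin n) (Fin n) ℝ)
    (u₀ : ℝ → Fin n → ℝ) (u : ℝ × ℝ → Fin n → ℝ) : Prop where
  analytic : AnalyticAt ℝ u (0, 0)
  equation : ∀ᶠ p : ℝ × ℝ in 𝓝 (0, 0),
    deriv (fun t => u (t, p.2)) p.1 = (L (u p)).mulVec (deriv (fun x => u (p.1, x)) p.2)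
  initial : ∀ᶠ x : ℝ in 𝓝 0, u (0, x) = u₀ x

end

/-! ### Uniqueness for `Z_t = C Z_x` with analytic data -/

section Transport

open Metric

variable {𝔸 : Type*} [NormedRing 𝔸] [NormedAlgebra ℝ 𝔸]

/-! Both claims are reduced to the companion matrix `C` of `λⁿ - a₁ λⁿ⁻¹ - … - aₙ`. If `A` is
`gl`-regular with characteristic coefficients `a`, then `companionTransfer` carries `r(C, tC + x
Id)` to `r(A, tA + x Id)` and kills only matrices annihilating the cyclic vector `e₀`. So `r(A, tA +
x Id) = 0` becomes `n` analytic equations in `(t, x, a)`, which at `t = x = 0` read `a = v(0)`. The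
implicit function theorem solves them by `a = f(t, x)`, and compactness of the cube `|aᵢ| ≤ R` makes
the neighbourhood uniform in `A`.

For a solution `u`, let `C` be the companion matrix of the characteristic coefficients of `L(u)`.
The Nijenhuis condition and Jacobi's formula give `C_t = C C_x`
(`IsNijenhuisOn.transportAt_charCoeff`). The equation `Z_t = C Z_x` is then inherited by `tC + x
Id`, by power series in it, and by products with powers of `C`, hence by `Y = r(C, tC + x Id)`. At
`t = 0` the coefficients of `C` are `vᵢ(x)`, so `Y = 0` by Cayley–Hamilton. Uniqueness
(`eq_zero_of_transport`) gives `Y = 0` near the origin, and the implicit function theorem identifies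
the coefficients with `f`. -/

theorem AnalyticOnNhd.fderiv_apply {E F : Type*} [NormedAddCommGroup E] [NormedSpace ℝ E]
    [NormedAddCommGroup F] [NormedSpace ℝ F] [CompleteSpace F] {f : E → F} {s : Set E}
    (hf : AnalyticOnNhd ℝ f s) (v : E) : AnalyticOnNhd ℝ (fun p => fderiv ℝ f p v) s :=
  fun p hp => ((ContinuousLinearMap.apply ℝ F v).analyticAt _).comp (hf.fderiv p hp)

/-- `Z` vanishes on `{t = 0} ∩ s` together with its `t`-derivatives of order at most `k`. -/
def VanishesToOrder (s : Set (ℝ × ℝ)) : ℕ → (ℝ × ℝ → 𝔸) → Prop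
  | 0, Z => ∀ x, ((0 : ℝ), x) ∈ s → Z (0, x) = 0
  | k + 1, Z => (∀ x, ((0 : ℝ), x) ∈ s → Z (0, x) = 0) ∧
      VanishesToOrder s k (fun p => fderiv ℝ Z p (1, 0))

namespace VanishesToOrder

variable {s : Set (ℝ × ℝ)} {Z W B : ℝ × ℝ → 𝔸} {k : ℕ}

theorem congr (hs : IsOpen s) (hZW : Set.EqOn Z W s) (h : VanishesToOrder s k Z) :
    VanishesToOrder s k W := by
  induction k generalizing Z W with
  | zero => exact fun x hx => (hZW hx).symm.trans (h x hx)
  | succ k ih =>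
    refine ⟨fun x hx => (hZW hx).symm.trans (h.1 x hx), ih (fun p hp => ?_) h.2⟩
    have : Z =ᶠ[𝓝 p] W := hZW.eventuallyEq_of_mem (hs.mem_nhds hp)
    simp only [this.fderiv_eq]

theorem of_succ (h : VanishesToOrder s (k + 1) Z) : VanishesToOrder s k Z := by
  induction k generalizing Z with
  | zero => exact h.1
  | succ k ih => exact ⟨h.1, ih h.2⟩

theorem add [CompleteSpace 𝔸] (hs : IsOpen s) (hZ : AnalyticOnNhd ℝ Z s) (hW : AnalyticOnNhd ℝ W s)
    (h : VanishesToOrder s k Z) (h' : VanishesToOrder s k W) :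
    VanishesToOrder s k (fun p => Z p + W p) := by
  induction k generalizing Z W with
  | zero => exact fun x hx => by simp only [h x hx, h' x hx, add_zero]
  | succ k ih =>
    refine ⟨fun x hx => by simp only [h.1 x hx, h'.1 x hx, add_zero], ?_⟩
    refine (ih (Z := fun p => fderiv ℝ Z p (1, 0)) (W := fun p => fderiv ℝ W p (1, 0))
      (hZ.fderiv_apply _)
      (hW.fderiv_apply _) h.2 h'.2).congr hs (fun p hp => ?_)
    simp only [fderiv_fun_add (hZ p hp).differentiableAt (hW p hp).differentiableAt,
      add_apply]

theorem mul_left [CompleteSpace 𝔸] (hs : IsOpen s) (hB : AnalyticOnNhd ℝ B s) (hZ : AnalyticOnNhd ℝ Z s)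
    (h : VanishesToOrder s k Z) : VanishesToOrder s k (fun p => B p * Z p) := by
  induction k generalizing Z B with
  | zero => exact fun x hx => by simp only [h x hx, mul_zero]
  | succ k ih =>
    refine ⟨fun x hx => by simp only [h.1 x hx, mul_zero], ?_⟩
    have hB' : AnalyticOnNhd ℝ (fun p => fderiv ℝ B p (1, 0)) s :=
      hB.fderiv_apply _
    have hZ' : AnalyticOnNhd ℝ (fun p => fderiv ℝ Z p (1, 0)) s :=
      hZ.fderiv_apply _
    refine ((ih hB hZ' h.2).add hs (hB.mul hZ') (hB'.mul hZ) (ih hB' hZ h.of_succ)).congr hs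
      (fun p hp => ?_)
    simp [fderiv_fun_mul' (hB p hp).differentiableAt (hZ p hp).differentiableAt]

/-- The `x`-direction is tangent to `t = 0`, so differentiating in it keeps the zero data; for the
higher orders, mixed partial derivatives commute. -/
theorem fderiv_snd [CompleteSpace 𝔸] (hs : IsOpen s) (hZ : AnalyticOnNhd ℝ Z s) (h : VanishesToOrder s k Z) :
    VanishesToOrder s k (fun p => fderiv ℝ Z p (0, 1)) := by
  have key : ∀ {V : ℝ × ℝ → 𝔸}, AnalyticOnNhd ℝ V s → (∀ x, ((0 : ℝ), x) ∈ s → V (0, x) = 0) →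
      ∀ x, ((0 : ℝ), x) ∈ s → fderiv ℝ V (0, x) (0, 1) = 0 := by
    intro V hV h0 x hx
    have h1 : HasDerivAt (fun y : ℝ => V (0, y)) (fderiv ℝ V (0, x) (0, 1)) x :=
      (hV _ hx).differentiableAt.hasFDerivAt.comp_hasDerivAt x
        ((hasDerivAt_const x (0 : ℝ)).prodMk (hasDerivAt_id x))
    have h2 : (fun y : ℝ => V (0, y)) =ᶠ[𝓝 x] fun _ => 0 := by
      have : ∀ᶠ y : ℝ in 𝓝 x, ((0 : ℝ), y) ∈ s :=
        (Continuous.prodMk_right (0 : ℝ)).continuousAt.preimage_mem_nhds (hs.mem_nhds hx)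
      filter_upwards [this] with y hy using h0 y hy
    exact h1.unique ((hasDerivAt_const x (0 : 𝔸)).congr_of_eventuallyEq h2)
  induction k generalizing Z with
  | zero => exact key hZ h
  | succ k ih =>
    refine ⟨key hZ h.1, ?_⟩
    have hZ' : AnalyticOnNhd ℝ (fun p => fderiv ℝ Z p (1, 0)) s :=
      hZ.fderiv_apply _
    refine (ih hZ' h.2).congr hs (fun p hp => ?_)
    have hd := (hZ.fderiv p hp).differentiableAt
    have hsymm := (hZ p hp).contDiffAt.isSymmSndFDerivAt_of_omega
    simp only [fderiv_clm_apply hd (differentiableAt_const _), fderiv_fun_const]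
    simpa using hsymm (0, 1) (1, 0)

theorem iteratedDeriv_eq_zero [CompleteSpace 𝔸] (hs : IsOpen s) (hZ : AnalyticOnNhd ℝ Z s)
    (h : VanishesToOrder s k Z) {x : ℝ} (hx : ((0 : ℝ), x) ∈ s) :
    iteratedDeriv k (fun t => Z (t, x)) 0 = 0 := by
  induction k generalizing Z with
  | zero => simpa using h x hx
  | succ k ih =>
    have hZ' : AnalyticOnNhd ℝ (fun p => fderiv ℝ Z p (1, 0)) s :=
      hZ.fderiv_apply _
    rw [iteratedDeriv_succ', ← ih hZ' h.2]
    refine Filter.EventuallyEq.iteratedDeriv_eq k ?_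
    have : ∀ᶠ t : ℝ in 𝓝 0, (t, x) ∈ s :=
      (Continuous.prodMk_left x).continuousAt.preimage_mem_nhds (hs.mem_nhds hx)
    filter_upwards [this] with t ht
    exact ((hZ _ ht).differentiableAt.hasFDerivAt.comp_hasDerivAt t
      ((hasDerivAt_id t).prodMk (hasDerivAt_const t x))).deriv

end VanishesToOrder

/-- Uniqueness for the linear analytic system `Y_t = C Y_x`. -/
theorem eq_zero_of_transport [CompleteSpace 𝔸] {ε : ℝ} {C Y : ℝ × ℝ → 𝔸}
    (hC : AnalyticOnNhd ℝ C (ball 0 ε)) (hY : AnalyticOnNhd ℝ Y (ball 0 ε))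
    (h : ∀ p ∈ ball (0 : ℝ × ℝ) ε, fderiv ℝ Y p (1, 0) = C p * fderiv ℝ Y p (0, 1))
    (h0 : ∀ x, ((0 : ℝ), x) ∈ ball (0 : ℝ × ℝ) ε → Y (0, x) = 0) :
    ∀ p ∈ ball (0 : ℝ × ℝ) ε, Y p = 0 := by
  have hV : ∀ k, VanishesToOrder (ball (0 : ℝ × ℝ) ε) k Y := by
    intro k
    induction k with
    | zero => exact h0
    | succ k ih =>
      -- The equation trades one `t`-derivative for an `x`-derivative, which costs no order of
      -- vanishing.
      refine ⟨h0, ((ih.fderiv_snd isOpen_ball hY).mul_left isOpen_ball hC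
        (hY.fderiv_apply _)).congr isOpen_ball
        (fun p hp => (h p hp).symm)⟩
  rintro ⟨t, x⟩ hp
  -- The norm on `ℝ × ℝ` is the sup norm, so every horizontal slice of the ball is the whole
  -- interval `|t'| < ε`; the identity theorem then applies along it.
  have hmem : ∀ t' : ℝ, (t', x) ∈ ball (0 : ℝ × ℝ) ε ↔ |t'| < ε ∧ |x| < ε := by
    intro t'
    simp [Prod.norm_def]
  have hx : |x| < ε := ((hmem t).1 hp).2
  have hε : 0 < ε := (abs_nonneg x).trans_lt hx
  have hg : AnalyticOnNhd ℝ (fun t' : ℝ => Y (t', x)) (ball 0 ε) := by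
    intro t' ht'
    have : (t', x) ∈ ball (0 : ℝ × ℝ) ε := (hmem t').2 ⟨by simpa using ht', hx⟩
    exact (hY _ this).comp₂ analyticAt_id analyticAt_const
  have h00 : (0 : ℝ) ∈ ball (0 : ℝ) ε := by simpa using hε
  have htop : (fun t' : ℝ => Y (t', x)) =ᶠ[𝓝 0] 0 := by
    have : analyticOrderAt (fun t' : ℝ => Y (t', x)) 0 = ⊤ := by
      refine ENat.eq_top_iff_forall_ge.2 fun m => ?_
      refine (natCast_le_analyticOrderAt_iff_iteratedDeriv_eq_zero (hg 0 h00)).2 fun i _ => ?_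
      exact (hV i).iteratedDeriv_eq_zero isOpen_ball hY ((hmem 0).2 ⟨by simpa using hε, hx⟩)
    exact analyticOrderAt_eq_top.1 this
  exact hg.eqOn_zero_of_preconnected_of_eventuallyEq_zero (convex_ball _ _).isPreconnected h00 htop
    (by simpa using ((hmem t).1 hp).1)

end Transport

/-! ### Real power series evaluated in a Banach algebra -/

section PowerSeries

open Metric FormalMultilinearSeries

variable {𝔸 : Type*} [NormedRing 𝔸] [NormedAlgebra ℝ 𝔸] [NormOneClass 𝔸] {c : ℕ → ℝ}

theorem norm_smul_pow_le_geometric {r K : ℝ} (hr : 0 < r) (hc : ∀ k, |c k| * r ^ k ≤ K) {z : 𝔸}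
    (k : ℕ) : ‖c k • z ^ k‖ ≤ K * (‖z‖ / r) ^ k := by
  calc ‖c k • z ^ k‖ ≤ |c k| * ‖z‖ ^ k := by
        rw [norm_smul, Real.norm_eq_abs]
        gcongr
        exact norm_pow_le z k
    _ = |c k| * r ^ k * (‖z‖ / r) ^ k := by
        rw [div_pow]; field_simp
    _ ≤ K * (‖z‖ / r) ^ k := by gcongr; exact hc k

theorem summable_smul_pow [CompleteSpace 𝔸] {r K : ℝ} (hr : 0 < r)
    (hc : ∀ k, |c k| * r ^ k ≤ K) {z : 𝔸} (hz : ‖z‖ < r) :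
    Summable (fun k => c k • z ^ k) :=
  Summable.of_norm_bounded ((summable_geometric_of_lt_one (by positivity)
    ((div_lt_one hr).2 hz)).mul_left K) (norm_smul_pow_le_geometric hr hc)

theorem analyticAt_tsum_smul_pow [CompleteSpace 𝔸] {r K : ℝ} (hr : 0 < r)
    (hc : ∀ k, |c k| * r ^ k ≤ K) {z : 𝔸} (hz : ‖z‖ < r) :
    AnalyticAt ℝ (fun z : 𝔸 => ∑' k, c k • z ^ k) z := by
  lift r to NNReal using hr.le
  have hrad : (r : ENNReal) ≤ (ofScalars 𝔸 c).radius := by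
    refine le_radius_of_bound _ K fun k => ?_
    rw [ofScalars_norm]
    exact hc k
  have hpos : 0 < (ofScalars 𝔸 c).radius :=
    lt_of_lt_of_le (by exact_mod_cast hr) hrad
  have h := (ofScalars 𝔸 c).hasFPowerSeriesOnBall hpos
  have hs : (ofScalars 𝔸 c).sum = fun z : 𝔸 => ∑' k, c k • z ^ k := ofScalarsSum_eq_tsum c
  rw [hs] at h
  refine h.analyticAt_of_mem ?_
  refine Metric.eball_subset_eball hrad ?_
  rw [Metric.mem_eball, edist_zero_right]
  rw [← ofReal_norm, ENNReal.ofReal_lt_coe_iff (norm_nonneg _)]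
  exact hz

theorem fderiv_pow_apply_eq_sum {𝔸 : Type*} [NormedRing 𝔸] [NormedAlgebra ℝ 𝔸] (k : ℕ) (w g : 𝔸) :
    fderiv ℝ (fun x : 𝔸 => x ^ k) w g = ∑ i ∈ Finset.range k, w ^ (k.pred - i) * (g * w ^ i) := by
  rw [(hasFDerivAt_pow' (𝕜 := ℝ) k (x := w)).fderiv]
  simp [mul_assoc]

theorem norm_fderiv_pow_le (k : ℕ) {w : 𝔸} {ρ : ℝ} (hw : ‖w‖ ≤ ρ) :
    ‖fderiv ℝ (fun x : 𝔸 => x ^ k) w‖ ≤ k * ρ ^ (k - 1) := by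
  have hρ : 0 ≤ ρ := (norm_nonneg w).trans hw
  refine ContinuousLinearMap.opNorm_le_bound _ (by positivity) fun g => ?_
  rw [fderiv_pow_apply_eq_sum]
  have hterm : ∀ i ∈ Finset.range k, ‖w ^ (k.pred - i) * (g * w ^ i)‖ ≤ ρ ^ (k - 1) * ‖g‖ := by
    intro i hi
    have hi' : (k.pred - i) + i = k - 1 := by
      have := Finset.mem_range.1 hi
      simp only [Nat.pred_eq_sub_one]; omega
    calc ‖w ^ (k.pred - i) * (g * w ^ i)‖ ≤ ‖w‖ ^ (k.pred - i) * (‖g‖ * ‖w‖ ^ i) :=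
          (norm_mul_le _ _).trans (mul_le_mul (norm_pow_le _ _) ((norm_mul_le _ _).trans
            (mul_le_mul_of_nonneg_left (norm_pow_le _ _) (norm_nonneg _))) (norm_nonneg _)
            (by positivity))
      _ = ‖w‖ ^ (k - 1) * ‖g‖ := by rw [← hi', pow_add]; ring
      _ ≤ ρ ^ (k - 1) * ‖g‖ :=
          mul_le_mul_of_nonneg_right (pow_le_pow_left₀ (norm_nonneg _) hw _) (norm_nonneg _)
  refine (norm_sum_le _ _).trans ((Finset.sum_le_sum hterm).trans (le_of_eq ?_))
  simp [mul_assoc]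

theorem coeff_mul_deriv_pow_le {r K ρ : ℝ} (hr : 0 < r) (hρ : 0 < ρ)
    (hc : ∀ k, |c k| * r ^ k ≤ K) (k : ℕ) :
    |c k| * (k * ρ ^ (k - 1)) ≤ K / ρ * ((k : ℝ) ^ 1 * (ρ / r) ^ k) := by
  rcases Nat.eq_zero_or_pos k with rfl | hk
  · simp
  obtain ⟨m, rfl⟩ : ∃ m, k = m + 1 := ⟨k - 1, by omega⟩
  calc |c (m + 1)| * ((m + 1 : ℕ) * ρ ^ (m + 1 - 1))
      = |c (m + 1)| * r ^ (m + 1) * (1 / ρ * ((m + 1 : ℕ) * (ρ / r) ^ (m + 1))) := by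
        rw [div_pow, Nat.add_sub_cancel, pow_succ ρ m]
        field_simp
    _ ≤ K * (1 / ρ * ((m + 1 : ℕ) * (ρ / r) ^ (m + 1))) :=
        mul_le_mul_of_nonneg_right (hc _) (by positivity)
    _ = K / ρ * (((m + 1 : ℕ) : ℝ) ^ 1 * (ρ / r) ^ (m + 1)) := by ring

theorem hasFDerivAt_tsum_smul_pow [CompleteSpace 𝔸] {r K : ℝ} (hr : 0 < r)
    (hc : ∀ k, |c k| * r ^ k ≤ K) {z : 𝔸} (hz : ‖z‖ < r) :
    Summable (fun k => c k • fderiv ℝ (fun x : 𝔸 => x ^ k) z) ∧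
      HasFDerivAt (fun z : 𝔸 => ∑' k, c k • z ^ k)
        (∑' k, c k • fderiv ℝ (fun x : 𝔸 => x ^ k) z) z := by
  -- On the ball of an intermediate radius `ρ`, the differentiated series is dominated by a multiple
  -- of `k (ρ / r)ᵏ`.
  obtain ⟨ρ, hzρ, hρr⟩ := exists_between hz
  have hρ : 0 < ρ := (norm_nonneg z).trans_lt hzρ
  have hu : Summable fun k : ℕ => K / ρ * ((k : ℝ) ^ 1 * (ρ / r) ^ k) := by
    have h1 : ‖ρ / r‖ < 1 := by
      rw [Real.norm_of_nonneg (by positivity)]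
      exact (div_lt_one hr).2 hρr
    have h2 := summable_pow_mul_geometric_of_norm_lt_one 1 h1
    exact h2.mul_left _
  have hbound : ∀ k (w : 𝔸), w ∈ ball (0 : 𝔸) ρ →
      ‖c k • fderiv ℝ (fun x : 𝔸 => x ^ k) w‖ ≤ K / ρ * ((k : ℝ) ^ 1 * (ρ / r) ^ k) := by
    intro k w hw
    rw [mem_ball_zero_iff] at hw
    refine le_trans ?_ (coeff_mul_deriv_pow_le hr hρ hc k)
    rw [norm_smul, Real.norm_eq_abs]
    exact mul_le_mul_of_nonneg_left (norm_fderiv_pow_le k hw.le) (abs_nonneg _)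
  have hzb : z ∈ ball (0 : 𝔸) ρ := by simpa using hzρ
  have hderiv : ∀ (k : ℕ) (w : 𝔸), w ∈ ball (0 : 𝔸) ρ → HasFDerivAt (fun z : 𝔸 => c k • z ^ k)
      (c k • fderiv ℝ (fun x : 𝔸 => x ^ k) w) w := fun k w _ =>
    (differentiableAt_fun_id.fun_pow k).hasFDerivAt.const_smul (c k)
  exact ⟨Summable.of_norm_bounded hu fun k => hbound k z hzb,
    hasFDerivAt_tsum_of_isPreconnected hu isOpen_ball (convex_ball _ _).isPreconnected
      hderiv hbound hzb (summable_smul_pow hr hc hz) hzb⟩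

/-- Each `d(zᵏ)(h)` is a sum of terms `zⁱ h zʲ`, and `a` moves past the left factor only. Hence `h`
need not commute with anything, which matters because it will be `Z_x`. -/
theorem fderiv_tsum_smul_pow_mul_of_commute [CompleteSpace 𝔸] {r K : ℝ} (hr : 0 < r)
    (hc : ∀ k, |c k| * r ^ k ≤ K) {z a : 𝔸} (hz : ‖z‖ < r) (ha : Commute a z) (h : 𝔸) :
    fderiv ℝ (fun z : 𝔸 => ∑' k, c k • z ^ k) z (a * h) =
      a * fderiv ℝ (fun z : 𝔸 => ∑' k, c k • z ^ k) z h := by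
  obtain ⟨hs, hd⟩ := hasFDerivAt_tsum_smul_pow hr hc hz
  have happ : ∀ g, HasSum (fun k => c k • fderiv ℝ (fun x : 𝔸 => x ^ k) z g)
      (fderiv ℝ (fun z : 𝔸 => ∑' k, c k • z ^ k) z g) := by
    intro g
    rw [hd.fderiv]
    have h1 := ContinuousLinearMap.hasSum (ContinuousLinearMap.apply ℝ 𝔸 g) hs.hasSum
    simpa using h1
  refine (happ (a * h)).unique ?_
  have h1 := (happ h).mul_left a
  refine h1.congr_fun fun k => ?_
  simp only [fderiv_pow_apply_eq_sum, mul_smul_comm, Finset.mul_sum]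
  congr 1
  refine Finset.sum_congr rfl fun i _ => ?_
  rw [← mul_assoc a, (ha.pow_right _).eq, mul_assoc, mul_assoc]

end PowerSeries

/-! ### Closure properties of solutions of `Z_t = C Z_x` -/

section TransportSolutions

variable {𝔸 : Type*} [NormedRing 𝔸] [NormedAlgebra ℝ 𝔸]

/-- `Z` is differentiable at `p = (t, x)` and satisfies `Z_t = C Z_x` there. -/
def TransportAt (C Z : ℝ × ℝ → 𝔸) (p : ℝ × ℝ) : Prop :=
  DifferentiableAt ℝ Z p ∧ fderiv ℝ Z p (1, 0) = C p * fderiv ℝ Z p (0, 1)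

namespace TransportAt

variable {C Z W : ℝ × ℝ → 𝔸} {p : ℝ × ℝ}

/-- In `(Z W)_t = C Z_x W + Z C W_x` the factor `C` can be pulled out as soon as `Z` commutes with
it; no condition on `W` arises. -/
theorem mul (hZ : TransportAt C Z p) (hW : TransportAt C W p) (hc : Commute (C p) (Z p)) :
    TransportAt C (fun q => Z q * W q) p := by
  refine ⟨hZ.1.mul hW.1, ?_⟩
  simp only [fderiv_fun_mul' hZ.1 hW.1, add_apply, smul_apply, smul_eq_mul, MulOpposite.smul_eq_mul_unop,
    MulOpposite.unop_op, hZ.2, hW.2, mul_add]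
  rw [← mul_assoc, ← hc.eq, mul_assoc, mul_assoc]

theorem sub (hZ : TransportAt C Z p) (hW : TransportAt C W p) :
    TransportAt C (fun q => Z q - W q) p := by
  refine ⟨hZ.1.sub hW.1, ?_⟩
  simp only [fderiv_fun_sub hZ.1 hW.1, sub_apply, hZ.2, hW.2, mul_sub]

theorem const (a : 𝔸) : TransportAt C (fun _ => a) p := by
  refine ⟨differentiableAt_const a, ?_⟩
  simp

theorem sum {ι : Type*} {s : Finset ι} {Z : ι → ℝ × ℝ → 𝔸} (h : ∀ i ∈ s, TransportAt C (Z i) p) :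
    TransportAt C (fun q => ∑ i ∈ s, Z i q) p := by
  refine ⟨DifferentiableAt.fun_sum fun i hi => (h i hi).1, ?_⟩
  rw [fderiv_fun_sum fun i hi => (h i hi).1]
  simp only [sum_apply, Finset.mul_sum]
  exact Finset.sum_congr rfl fun i hi => (h i hi).2

theorem pow (hC : TransportAt C C p) (k : ℕ) : TransportAt C (fun q => C q ^ k) p := by
  induction k with
  | zero => simpa using const 1
  | succ k ih => simpa only [pow_succ] using ih.mul hC ((Commute.refl _).pow_right k)

/-- Both sides equal `C + t C C_x`: the derivative of the explicit `t` yields `C`, that of the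
explicit `x` yields `1`. -/
theorem pencil (hC : TransportAt C C p) :
    TransportAt C (fun q => q.1 • C q + q.2 • (1 : 𝔸)) p := by
  have h : HasFDerivAt (fun q : ℝ × ℝ => q.1 • C q + q.2 • (1 : 𝔸)) _ p :=
    (hasFDerivAt_fst.smul hC.1.hasFDerivAt).add (hasFDerivAt_snd.smul_const (1 : 𝔸))
  refine ⟨h.differentiableAt, ?_⟩
  rw [h.fderiv]
  simp [hC.2, mul_add, add_comm]

theorem tsum_smul_pow [CompleteSpace 𝔸] [NormOneClass 𝔸] {c : ℕ → ℝ} {r K : ℝ} (hr : 0 < r)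
    (hc : ∀ k, |c k| * r ^ k ≤ K) (hZ : TransportAt C Z p) (hZr : ‖Z p‖ < r)
    (hcomm : Commute (C p) (Z p)) : TransportAt C (fun q => ∑' k, c k • Z q ^ k) p := by
  have h : HasFDerivAt (fun q => ∑' k, c k • Z q ^ k) _ p :=
    (analyticAt_tsum_smul_pow hr hc hZr).differentiableAt.hasFDerivAt.comp p hZ.1.hasFDerivAt
  refine ⟨h.differentiableAt, ?_⟩
  rw [h.fderiv, ContinuousLinearMap.comp_apply, ContinuousLinearMap.comp_apply, hZ.2]
  exact fderiv_tsum_smul_pow_mul_of_commute hr hc hZr hcomm _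

end TransportAt

end TransportSolutions

theorem AnalyticAt.exists_taylor_bound {v : ℝ → ℝ} (hv : AnalyticAt ℝ v 0) :
    ∃ r > 0, ∃ K, (∀ k, |iteratedDeriv k v 0 / (k.factorial : ℝ)| * r ^ k ≤ K) ∧
      ∀ x, |x| < r → HasSum (fun k => iteratedDeriv k v 0 / (k.factorial : ℝ) * x ^ k) (v x) := by
  obtain ⟨R, hR⟩ := hv.hasFPowerSeriesAt
  obtain ⟨r, hr0, hrR⟩ := ENNReal.lt_iff_exists_nnreal_btwn.1 hR.r_pos
  have hr0' : (0 : ℝ) < r := by exact_mod_cast hr0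
  obtain ⟨K, -, hK⟩ := FormalMultilinearSeries.norm_mul_pow_le_of_lt_radius _
    (hrR.trans_le hR.r_le)
  refine ⟨r, hr0', K, fun k => ?_, fun x hx => ?_⟩
  · simpa only [FormalMultilinearSeries.ofScalars_norm, Real.norm_eq_abs] using hK k
  · have hx' : x ∈ Metric.eball (0 : ℝ) R := by
      refine Metric.eball_subset_eball hrR.le ?_
      rw [Metric.mem_eball, edist_zero_right, ← ofReal_norm,
        ENNReal.ofReal_lt_coe_iff (norm_nonneg _)]
      exact hx
    simpa [FormalMultilinearSeries.ofScalars_apply_eq, mul_comm] using hR.hasSum hx'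

/-! ### Companion matrices and transfer to `gl`-regular matrices -/

section Companion

open Matrix Polynomial

variable {n : ℕ}

theorem Fin.val_rev_eq_sub (i : Fin n) : (i.rev : ℕ) = n - 1 - i := by
  rw [Fin.val_rev]; omega

theorem charpoly_eq_sub_sum_charCoeff (A : Matrix (Fin n) (Fin n) ℝ) :
    A.charpoly = X ^ n - ∑ i : Fin n, C (charCoeff A i) * X ^ (n - 1 - (i : ℕ)) := by
  have hdeg : A.charpoly.natDegree = n := by simp [A.charpoly_natDegree_eq_dim]
  have hlead : A.charpoly.coeff n = 1 := by
    have := A.charpoly_monic.leadingCoeff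
    rwa [leadingCoeff, hdeg] at this
  have h : ∑ i : Fin n, C (charCoeff A i) * X ^ (n - 1 - (i : ℕ)) =
      -∑ k : Fin n, C (A.charpoly.coeff k) * X ^ (k : ℕ) := by
    rw [← Equiv.sum_comp Fin.revPerm (fun k : Fin n => C (A.charpoly.coeff k) * X ^ (k : ℕ)),
      ← Finset.sum_neg_distrib]
    refine Finset.sum_congr rfl fun i _ => ?_
    simp [charCoeff, Fin.val_rev_eq_sub, -Fin.val_rev]
  conv_lhs => rw [A.charpoly.as_sum_range_C_mul_X_pow, hdeg, Finset.sum_range_succ, hlead]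
  rw [h, Finset.sum_range]
  simp [add_comm]

theorem pow_eq_sum_charCoeff_smul (A : Matrix (Fin n) (Fin n) ℝ) :
    A ^ n = ∑ i : Fin n, charCoeff A i • A ^ (n - 1 - (i : ℕ)) := by
  have h := A.aeval_self_charpoly
  rw [charpoly_eq_sub_sum_charCoeff, map_sub, map_sum, sub_eq_zero] at h
  simpa [Algebra.smul_def] using h

/-- The companion matrix of `λⁿ - a₁ λⁿ⁻¹ - … - aₙ`. -/
def companionMatrix (a : Fin n → ℝ) : Matrix (Fin n) (Fin n) ℝ :=
  Matrix.of fun i j => if (j : ℕ) + 1 = n then a i.rev else if (i : ℕ) = j + 1 then 1 else 0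

theorem companionMatrix_mulVec_single_of_lt (a : Fin n → ℝ) {j : Fin n} (hj : (j : ℕ) + 1 < n) :
    companionMatrix a *ᵥ Pi.single j 1 = Pi.single ⟨j + 1, hj⟩ 1 := by
  ext i
  simp [companionMatrix, hj.ne, Pi.single_apply, Fin.ext_iff]

theorem companionMatrix_mulVec_single_last (a : Fin n → ℝ) {j : Fin n} (hj : (j : ℕ) + 1 = n) :
    companionMatrix a *ᵥ Pi.single j 1 = fun i => a i.rev := by
  ext i
  simp [companionMatrix, hj]

variable [NeZero n]

theorem companionMatrix_pow_mulVec (a : Fin n → ℝ) {k : ℕ} (hk : k < n) :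
    companionMatrix a ^ k *ᵥ Pi.single 0 1 = Pi.single ⟨k, hk⟩ 1 := by
  induction k with
  | zero => exact one_mulVec _
  | succ k ih =>
    rw [pow_succ', ← mulVec_mulVec, ih (by omega), companionMatrix_mulVec_single_of_lt a hk]

theorem companionMatrix_pow_self_mulVec (a : Fin n → ℝ) :
    companionMatrix a ^ n *ᵥ Pi.single 0 1 = fun i => a i.rev := by
  obtain ⟨m, rfl⟩ : ∃ m, n = m + 1 := ⟨n - 1, by have := NeZero.pos n; omega⟩
  rw [pow_succ', ← mulVec_mulVec, companionMatrix_pow_mulVec a (Nat.lt_succ_self m)]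
  exact companionMatrix_mulVec_single_last a rfl

/-- A polynomial of degree below `n` in the companion matrix is read off from its value on `e₀`. The
reversal appears because the coefficients are listed by descending powers. -/
theorem sum_smul_companionMatrix_pow_mulVec (a b : Fin n → ℝ) :
    (∑ i : Fin n, b i • companionMatrix a ^ (n - 1 - (i : ℕ))) *ᵥ Pi.single 0 1 =
      fun i => b i.rev := by
  have h : ∀ i : Fin n, companionMatrix a ^ (n - 1 - (i : ℕ)) *ᵥ Pi.single 0 1 =
      Pi.single i.rev 1 := by
    intro i
    rw [← Fin.val_rev_eq_sub, companionMatrix_pow_mulVec a i.rev.is_lt]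
  simp only [sum_mulVec, smul_mulVec, h]
  ext j
  rw [Finset.sum_apply, Finset.sum_eq_single j.rev]
  · simp
  · intro i _ hi
    have : j ≠ i.rev := fun h => hi (by rw [h, Fin.rev_rev])
    simp [this]
  · simp

/-- The two sides agree on `e₀` and commute with `C`, and the vectors `Cʲ e₀` form the standard
basis. -/
theorem companionMatrix_pow_self (a : Fin n → ℝ) :
    companionMatrix a ^ n = ∑ i : Fin n, a i • companionMatrix a ^ (n - 1 - (i : ℕ)) := by
  set C := companionMatrix a
  have h0 : (C ^ n) *ᵥ Pi.single 0 1 = (∑ i : Fin n, a i • C ^ (n - 1 - (i : ℕ))) *ᵥ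
      Pi.single 0 1 := by
    rw [companionMatrix_pow_self_mulVec, sum_smul_companionMatrix_pow_mulVec]
  have hcomm : ∀ k, Commute (∑ i : Fin n, a i • C ^ (n - 1 - (i : ℕ))) (C ^ k) := fun k =>
    Commute.sum_left _ _ _ fun i _ => ((Commute.refl C).pow_pow _ _).smul_left _
  refine Matrix.ext_of_mulVec_single fun j => ?_
  have hj : Pi.single j 1 = C ^ (j : ℕ) *ᵥ Pi.single 0 (1 : ℝ) :=
    (companionMatrix_pow_mulVec a j.is_lt).symm
  rw [hj, mulVec_mulVec, mulVec_mulVec, (hcomm j).eq, ← pow_add, add_comm, pow_add,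
    ← mulVec_mulVec, h0, mulVec_mulVec]

/-- The linear map `X ↦ ∑ₖ (X e₀)ₖ Aᵏ`. It intertwines multiplication by the companion matrix of
`A` with multiplication by `A`. -/
def companionTransfer (A : Matrix (Fin n) (Fin n) ℝ) :
    Matrix (Fin n) (Fin n) ℝ →ₗ[ℝ] Matrix (Fin n) (Fin n) ℝ :=
  (Fintype.linearCombination ℝ fun k : Fin n => A ^ (k : ℕ)) ∘ₗ
    (Matrix.mulVecBilin ℝ ℝ).flip (Pi.single 0 1)

theorem companionTransfer_apply (A B : Matrix (Fin n) (Fin n) ℝ) :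
    companionTransfer A B =
      Fintype.linearCombination ℝ (fun k : Fin n => A ^ (k : ℕ)) (B *ᵥ Pi.single 0 1) := rfl

/-- The only place where `gl`-regularity enters: it is injectivity of `w ↦ ∑ₖ wₖ Aᵏ`. -/
theorem companionTransfer_eq_zero_iff {A : Matrix (Fin n) (Fin n) ℝ} (hA : IsGlRegular A)
    (B : Matrix (Fin n) (Fin n) ℝ) : companionTransfer A B = 0 ↔ B *ᵥ Pi.single 0 1 = 0 := by
  rw [companionTransfer_apply]
  exact map_eq_zero_iff _ (LinearIndependent.fintypeLinearCombination_injective hA)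

theorem companionTransfer_one (A : Matrix (Fin n) (Fin n) ℝ) : companionTransfer A 1 = 1 := by
  rw [companionTransfer_apply, one_mulVec, Fintype.linearCombination_apply_single]
  simp

/-- On `eⱼ` with `j` not last this is `A · Aʲ = Aʲ⁺¹`; on the last basis vector it is
Cayley–Hamilton for `A`. -/
theorem companionTransfer_mul (A B : Matrix (Fin n) (Fin n) ℝ) :
    companionTransfer A (companionMatrix (charCoeff A) * B) = A * companionTransfer A B := by
  have h : Fintype.linearCombination ℝ (fun k : Fin n => A ^ (k : ℕ)) ∘ₗ
      (companionMatrix (charCoeff A)).mulVecLin =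
      (LinearMap.mulLeft ℝ A) ∘ₗ Fintype.linearCombination ℝ (fun k : Fin n => A ^ (k : ℕ)) := by
    refine LinearMap.pi_ext fun j x => ?_
    have hx : (Pi.single j x : Fin n → ℝ) = x • Pi.single j 1 := by
      rw [← Pi.single_smul, smul_eq_mul, mul_one]
    rw [hx, map_smul, map_smul]
    congr 1
    simp only [LinearMap.comp_apply, mulVecLin_apply, LinearMap.mulLeft_apply,
      Fintype.linearCombination_apply_single, one_smul]
    rcases (Nat.succ_le_of_lt j.is_lt).lt_or_eq with hj | hj
    · rw [companionMatrix_mulVec_single_of_lt _ hj, Fintype.linearCombination_apply_single,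
        one_smul, ← pow_succ']
    · have hj' : (j : ℕ) + 1 = n := hj
      rw [companionMatrix_mulVec_single_last _ hj', Fintype.linearCombination_apply, ← pow_succ',
        hj', pow_eq_sum_charCoeff_smul, ← Equiv.sum_comp Fin.revPerm]
      refine Finset.sum_congr rfl fun i _ => ?_
      simp [Fin.val_rev_eq_sub, -Fin.val_rev]
  rw [companionTransfer_apply, companionTransfer_apply, ← mulVec_mulVec]
  exact LinearMap.congr_fun h _

theorem companionTransfer_pow_mul (A B : Matrix (Fin n) (Fin n) ℝ) (k : ℕ) :
    companionTransfer A (companionMatrix (charCoeff A) ^ k * B) = A ^ k * companionTransfer A B := by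
  induction k with
  | zero => simp
  | succ k ih => rw [pow_succ', mul_assoc, companionTransfer_mul, ih, pow_succ', mul_assoc]

theorem companionTransfer_pencil_pow_mul (A B : Matrix (Fin n) (Fin n) ℝ) (p : ℝ × ℝ) (k : ℕ) :
    companionTransfer A (pencil p (companionMatrix (charCoeff A)) ^ k * B) =
      pencil p A ^ k * companionTransfer A B := by
  induction k with
  | zero => simp
  | succ k ih =>
    have h : ∀ B, companionTransfer A (pencil p (companionMatrix (charCoeff A)) * B) =
        pencil p A * companionTransfer A B := by
      intro B
      simp [pencil, add_mul, companionTransfer_mul]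
    rw [pow_succ', mul_assoc, h, ih, pow_succ', mul_assoc]

theorem companionTransfer_taylorTerm_mul_pow (A : Matrix (Fin n) (Fin n) ℝ) (p : ℝ × ℝ)
    (v : ℝ → ℝ) (k j : ℕ) :
    companionTransfer A (taylorTerm v (pencil p (companionMatrix (charCoeff A))) k *
      companionMatrix (charCoeff A) ^ j) = taylorTerm v (pencil p A) k * A ^ j := by
  rw [taylorTerm, taylorTerm, smul_mul_assoc, map_smul, companionTransfer_pencil_pow_mul,
    smul_mul_assoc, ← mul_one (companionMatrix (charCoeff A) ^ j), companionTransfer_pow_mul,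
    companionTransfer_one, mul_one]

theorem summable_taylorTerm_pencil {A : Matrix (Fin n) (Fin n) ℝ} {p : ℝ × ℝ} {v : ℝ → ℝ}
    (h : Summable (taylorTerm v (pencil p (companionMatrix (charCoeff A))))) :
    Summable (taylorTerm v (pencil p A)) := by
  have h1 := h.map (companionTransfer A) (companionTransfer A).continuous_of_finiteDimensional
  refine h1.congr fun k => ?_
  simpa using (companionTransfer_taylorTerm_mul_pow A p v k 0)

theorem companionTransfer_rMatrix {A : Matrix (Fin n) (Fin n) ℝ} {p : ℝ × ℝ} {v : Fin n → ℝ → ℝ}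
    (h : ∀ i, Summable (taylorTerm (v i) (pencil p (companionMatrix (charCoeff A))))) :
    companionTransfer A (rMatrix v (companionMatrix (charCoeff A))
      (pencil p (companionMatrix (charCoeff A)))) = rMatrix v A (pencil p A) := by
  have hterm : ∀ i j, companionTransfer A (matrixFun (v i) (pencil p
      (companionMatrix (charCoeff A))) * companionMatrix (charCoeff A) ^ j) =
      matrixFun (v i) (pencil p A) * A ^ j := by
    intro i j
    have h1 := ((h i).hasSum.mul_right (companionMatrix (charCoeff A) ^ j)).map
      (companionTransfer A) (companionTransfer A).continuous_of_finiteDimensional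
    have h2 := (summable_taylorTerm_pencil (h i)).hasSum.mul_right (A ^ j)
    refine h1.unique (h2.congr_fun fun k => ?_)
    exact companionTransfer_taylorTerm_mul_pow A p (v i) k j
  have hpow := companionTransfer_pow_mul A 1 n
  rw [mul_one, companionTransfer_one, mul_one] at hpow
  rw [rMatrix, map_sub, map_sum, hpow, rMatrix]
  simp only [hterm]

end Companion

/-! ### Analyticity and the implicit function `f` -/

section MatrixAnalytic

open Matrix
open scoped Matrix.Norms.Operator

variable {n : ℕ} {E : Type*} [NormedAddCommGroup E] [NormedSpace ℝ E]

theorem analyticAt_matrix {G : E → Matrix (Fin n) (Fin n) ℝ} {x : E}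
    (h : ∀ i j, AnalyticAt ℝ (fun p => G p i j) x) : AnalyticAt ℝ G x := by
  have hG : G = fun p => ∑ i, ∑ j, G p i j • Matrix.single i j (1 : ℝ) := by
    funext p
    conv_lhs => rw [matrix_eq_sum_single (G p)]
    simp
  rw [hG]
  exact Finset.univ.analyticAt_fun_sum fun i _ => Finset.univ.analyticAt_fun_sum fun j _ =>
    (h i j).smul analyticAt_const

theorem analyticAt_charCoeff {G : E → Matrix (Fin n) (Fin n) ℝ} {x : E}
    (h : ∀ i j, AnalyticAt ℝ (fun p => G p i j) x) :
    AnalyticAt ℝ (fun p => charCoeff (G p)) x := by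
  refine analyticAt_pi_iff.2 fun i => ?_
  have h1 := AnalyticAt.aeval_mvPolynomial (f := fun p (ij : Fin n × Fin n) => G p ij.1 ij.2)
    (fun ij => h ij.1 ij.2) ((charpoly.univ ℝ (Fin n)).coeff (n - 1 - (i : ℕ)))
  refine h1.neg.congr (Eventually.of_forall fun p => ?_)
  have h2 := charpoly.univ_coeff_eval₂Hom (n := Fin n) (RingHom.id ℝ)
    (fun ij : Fin n × Fin n => G p ij.1 ij.2) (n - 1 - (i : ℕ))
  exact congrArg Neg.neg h2

theorem analyticAt_companionMatrix {a : E → Fin n → ℝ} {x : E} (ha : AnalyticAt ℝ a x) :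
    AnalyticAt ℝ (fun p => companionMatrix (a p)) x := by
  refine analyticAt_matrix fun i j => ?_
  simp only [companionMatrix, of_apply]
  split_ifs
  · exact analyticAt_pi_iff.1 ha i.rev
  · exact analyticAt_const
  · exact analyticAt_const

theorem pencil_zero (A : Matrix (Fin n) (Fin n) ℝ) : pencil (0, 0) A = 0 := by
  simp [pencil]

theorem analyticAt_pencil {G : E → Matrix (Fin n) (Fin n) ℝ} {g : E → ℝ × ℝ} {x : E}
    (hg : AnalyticAt ℝ g x) (hG : AnalyticAt ℝ G x) :
    AnalyticAt ℝ (fun q => pencil (g q) (G q)) x :=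
  ((analyticAt_fst.comp hg).smul hG).add ((analyticAt_snd.comp hg).smul analyticAt_const)

theorem commute_matrixFun_pencil (v : ℝ → ℝ) (p : ℝ × ℝ) (A : Matrix (Fin n) (Fin n) ℝ) :
    Commute A (matrixFun v (pencil p A)) := by
  have h : Commute A (pencil p A) :=
    ((Commute.refl A).smul_right _).add_right ((Commute.one_right _).smul_right _)
  exact Commute.tsum_right _ fun k => (h.pow_right k).smul_right _

variable [NeZero n]

theorem exists_matrixFun_bound {v : ℝ → ℝ} (hv : AnalyticAt ℝ v 0) :
    ∃ r > 0, (∀ M : Matrix (Fin n) (Fin n) ℝ, ‖M‖ < r →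
        Summable (taylorTerm v M) ∧ AnalyticAt ℝ (matrixFun (n := n) v) M) ∧
      (∀ (C : ℝ × ℝ → Matrix (Fin n) (Fin n) ℝ) (p : ℝ × ℝ), TransportAt C C p →
        ‖pencil p (C p)‖ < r → TransportAt C (fun q => matrixFun v (pencil q (C q))) p) ∧
      ∀ x, |x| < r → matrixFun v (x • (1 : Matrix (Fin n) (Fin n) ℝ)) = v x • 1 := by
  obtain ⟨r, hr, K, hK, hsum⟩ := hv.exists_taylor_bound
  refine ⟨r, hr, fun M hM => ⟨summable_smul_pow hr hK hM, analyticAt_tsum_smul_pow hr hK hM⟩,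
    fun C p hC hp => hC.pencil.tsum_smul_pow hr hK hp ?_, fun x hx => ?_⟩
  · exact ((Commute.refl (C p)).smul_right _).add_right ((Commute.one_right _).smul_right _)
  · have h := (hsum x hx).smul_const (1 : Matrix (Fin n) (Fin n) ℝ)
    refine (h.congr_fun fun k => ?_).tsum_eq
    rw [taylorTerm, smul_pow, one_pow, smul_smul]

/-- Cayley–Hamilton for the companion matrix makes the expression linear in `a - v(x)`. This gives
both the value of the residue at the origin and the vanishing of the initial data. -/
theorem rMatrix_smul_one {v : Fin n → ℝ → ℝ} {x : ℝ}
    (hv : ∀ i, matrixFun (v i) (x • (1 : Matrix (Fin n) (Fin n) ℝ)) = v i x • 1) (a : Fin n → ℝ) :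
    rMatrix v (companionMatrix a) (x • 1) =
      ∑ i : Fin n, (a i - v i x) • companionMatrix a ^ (n - 1 - (i : ℕ)) := by
  rw [rMatrix, companionMatrix_pow_self, ← Finset.sum_sub_distrib]
  refine Finset.sum_congr rfl fun i _ => ?_
  rw [hv, sub_smul, smul_mul_assoc, one_mul]

/-- The coefficients of `r(C, t C + x Id)` for the companion matrix `C` of `a`. -/
noncomputable def companionResidue (v : Fin n → ℝ → ℝ) (q : (ℝ × ℝ) × (Fin n → ℝ)) : Fin n → ℝ :=
  fun i => (rMatrix v (companionMatrix q.2) (pencil q.1 (companionMatrix q.2)) *ᵥ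
    Pi.single 0 1) i.rev

theorem companionResidue_eq_zero_iff {v : Fin n → ℝ → ℝ} {q : (ℝ × ℝ) × (Fin n → ℝ)} :
    companionResidue v q = 0 ↔
      rMatrix v (companionMatrix q.2) (pencil q.1 (companionMatrix q.2)) *ᵥ Pi.single 0 1 = 0 := by
  refine ⟨fun h => funext fun i => ?_, fun h => funext fun i => ?_⟩
  · simpa [companionResidue] using congrFun h i.rev
  · simp [companionResidue, h]

theorem companionResidue_zero {v : Fin n → ℝ → ℝ} (hv : ∀ i, AnalyticAt ℝ (v i) 0)
    (a : Fin n → ℝ) : companionResidue v ((0, 0), a) = fun i => a i - v i 0 := by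
  have h0 : ∀ i, matrixFun (v i) ((0 : ℝ) • (1 : Matrix (Fin n) (Fin n) ℝ)) = v i 0 • 1 := by
    intro i
    obtain ⟨r, hr, -, -, h⟩ := exists_matrixFun_bound (n := n) (hv i)
    exact h 0 (by simpa using hr)
  have hp : pencil ((0 : ℝ), (0 : ℝ)) (companionMatrix a) = (0 : ℝ) • 1 := by simp [pencil]
  ext i
  rw [companionResidue, hp, rMatrix_smul_one h0, sum_smul_companionMatrix_pow_mulVec]
  simp

theorem analyticAt_rMatrix_pencil {v : Fin n → ℝ → ℝ} (hv : ∀ i, AnalyticAt ℝ (v i) 0)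
    {G : E → Matrix (Fin n) (Fin n) ℝ} {g : E → ℝ × ℝ} {x : E}
    (hg : AnalyticAt ℝ g x) (hg0 : g x = (0, 0)) (hG : AnalyticAt ℝ G x) :
    AnalyticAt ℝ (fun q => rMatrix v (G q) (pencil (g q) (G q))) x := by
  refine (hG.pow n).sub (Finset.univ.analyticAt_fun_sum fun i _ => ?_)
  obtain ⟨r, hr, h, -, -⟩ := exists_matrixFun_bound (n := n) (hv i)
  have h0 : ‖pencil (g x) (G x)‖ < r := by rw [hg0, pencil_zero, norm_zero]; exact hr
  have h1 : AnalyticAt ℝ (fun q => matrixFun (v i) (pencil (g q) (G q))) x :=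
    AnalyticAt.comp (g := matrixFun (v i)) (f := fun q => pencil (g q) (G q)) (h _ h0).2
      (analyticAt_pencil hg hG)
  exact h1.mul (hG.pow _)

theorem analyticAt_companionResidue {v : Fin n → ℝ → ℝ} (hv : ∀ i, AnalyticAt ℝ (v i) 0)
    (a : Fin n → ℝ) : AnalyticAt ℝ (companionResidue v) ((0, 0), a) := by
  have h := analyticAt_rMatrix_pencil hv (x := (((0 : ℝ), (0 : ℝ)), a)) analyticAt_fst rfl
    (analyticAt_companionMatrix analyticAt_snd)
  refine analyticAt_pi_iff.2 fun i => ?_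
  let ℓ : Matrix (Fin n) (Fin n) ℝ →ₗ[ℝ] ℝ :=
    LinearMap.proj i.rev ∘ₗ (Matrix.mulVecBilin ℝ ℝ).flip (Pi.single 0 1)
  exact (ℓ.toContinuousLinearMap.analyticAt _).comp h

theorem exists_companionResidue_zero {v : Fin n → ℝ → ℝ} (hv : ∀ i, AnalyticAt ℝ (v i) 0) :
    ∃ f : ℝ × ℝ → Fin n → ℝ, AnalyticAt ℝ f (0, 0) ∧
      ∀ a, ∀ᶠ q : (ℝ × ℝ) × (Fin n → ℝ) in 𝓝 ((0, 0), a),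
        (∀ i, Summable (taylorTerm (v i) (pencil q.1 (companionMatrix q.2)))) ∧
        (companionResidue v q = 0 ↔ q.2 = f q.1) := by
  set a₀ : Fin n → ℝ := fun i => v i 0
  set q₀ : (ℝ × ℝ) × (Fin n → ℝ) := ((0, 0), a₀)
  have hcd : ContDiffAt ℝ ω (companionResidue v) q₀ := (analyticAt_companionResidue hv a₀).contDiffAt
  have hω : (ω : ℕ∞ω) ≠ 0 := by simp
  have hF0 : companionResidue v q₀ = 0 := by
    rw [companionResidue_zero hv]; ext i; simp [a₀]
  -- At `t = x = 0` the residue is `a - a₀`, so its partial derivative in `a` is the identity.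
  have hderiv : fderiv ℝ (companionResidue v) q₀ ∘L .inr ℝ (ℝ × ℝ) (Fin n → ℝ) =
      ContinuousLinearMap.id ℝ (Fin n → ℝ) := by
    have h1 : HasFDerivAt (fun a : Fin n → ℝ => companionResidue v ((0, 0), a))
        (fderiv ℝ (companionResidue v) q₀ ∘L .inr ℝ (ℝ × ℝ) (Fin n → ℝ)) a₀ :=
      HasFDerivAt.comp (g := companionResidue v) a₀
        (analyticAt_companionResidue hv a₀).differentiableAt.hasFDerivAt
        (hasFDerivAt_prodMk_right (0, 0) a₀)
    have h2 : (fun a : Fin n → ℝ => companionResidue v ((0, 0), a)) = fun a => a - a₀ :=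
      funext fun a => companionResidue_zero hv a
    rw [h2] at h1
    exact h1.unique ((hasFDerivAt_id a₀).sub_const a₀)
  have hinv : (fderiv ℝ (companionResidue v) q₀ ∘L .inr ℝ (ℝ × ℝ) (Fin n → ℝ)).IsInvertible := by
    rw [hderiv]
    exact ⟨ContinuousLinearEquiv.refl ℝ _, rfl⟩
  set f := hcd.implicitFunction hω hinv
  have hfa : AnalyticAt ℝ f (0, 0) :=
    (hcd.contDiffAt_implicitFunction hω hinv).analyticAt
  have hf0 : f (0, 0) = a₀ := hcd.implicitFunction_apply_self hω hinv
  refine ⟨f, hfa, fun a => ?_⟩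
  have hsum : ∀ᶠ q : (ℝ × ℝ) × (Fin n → ℝ) in 𝓝 ((0, 0), a),
      ∀ i, Summable (taylorTerm (v i) (pencil q.1 (companionMatrix q.2))) := by
    refine eventually_all.2 fun i => ?_
    obtain ⟨r, hr, h, -, -⟩ := exists_matrixFun_bound (n := n) (hv i)
    have hc : ContinuousAt (fun q : (ℝ × ℝ) × (Fin n → ℝ) =>
        ‖pencil q.1 (companionMatrix q.2)‖) ((0, 0), a) :=
      (analyticAt_pencil analyticAt_fst (analyticAt_companionMatrix analyticAt_snd)).continuousAt.norm
    have h0 : ‖pencil ((0 : ℝ), (0 : ℝ)) (companionMatrix a)‖ < r := by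
      rw [pencil_zero, norm_zero]; exact hr
    filter_upwards [hc.eventually_lt continuousAt_const h0] with q hq using (h _ hq).1
  refine hsum.and ?_
  -- The implicit function theorem covers only `a` near `a₀`. Near any other `a` both sides of the
  -- equivalence are false, by continuity.
  by_cases ha : a = a₀
  · subst ha
    filter_upwards [hcd.eventually_apply_eq_iff_implicitFunction hω hinv] with q hq
    rw [hF0] at hq
    rw [hq, eq_comm]
  · have hF : ∀ᶠ q : (ℝ × ℝ) × (Fin n → ℝ) in 𝓝 ((0, 0), a), companionResidue v q ≠ 0 := by
      refine (analyticAt_companionResidue hv a).continuousAt.eventually_ne ?_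
      rw [companionResidue_zero hv]
      intro h
      exact ha (funext fun i => sub_eq_zero.1 (congrFun h i))
    have hf : ∀ᶠ q : (ℝ × ℝ) × (Fin n → ℝ) in 𝓝 ((0, 0), a), q.2 - f q.1 ≠ 0 := by
      have hc : ContinuousAt (fun q : (ℝ × ℝ) × (Fin n → ℝ) => q.2 - f q.1) ((0, 0), a) :=
        continuousAt_snd.sub (ContinuousAt.comp (f := Prod.fst) hfa.continuousAt continuousAt_fst)
      refine hc.eventually_ne ?_
      simpa [hf0, sub_eq_zero] using ha
    filter_upwards [hF, hf] with q h1 h2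
    exact ⟨fun h => absurd h h1, fun h => absurd (sub_eq_zero.2 h) h2⟩

/-- The equivalence is local in `a`; the tube lemma over the compact cube `|aᵢ| ≤ R` gives one
neighbourhood of `(0, 0)` for all `A`. -/
theorem eventually_rMatrix_pencil_eq_zero_iff {v : Fin n → ℝ → ℝ} {f : ℝ × ℝ → Fin n → ℝ}
    (hf : ∀ a, ∀ᶠ q : (ℝ × ℝ) × (Fin n → ℝ) in 𝓝 ((0, 0), a),
        (∀ i, Summable (taylorTerm (v i) (pencil q.1 (companionMatrix q.2)))) ∧
        (companionResidue v q = 0 ↔ q.2 = f q.1)) (R : ℝ) :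
    ∀ᶠ p : ℝ × ℝ in 𝓝 (0, 0), ∀ A : Matrix (Fin n) (Fin n) ℝ,
      IsGlRegular A → (∀ i, |charCoeff A i| ≤ R) →
        (∀ i, Summable (taylorTerm (v i) (pencil p A))) ∧
        (rMatrix v A (pencil p A) = 0 ↔ ∀ i, charCoeff A i = f p i) := by
  have hK : IsCompact (Set.univ.pi fun _ : Fin n => Set.Icc (-R) R) :=
    isCompact_univ_pi fun _ => isCompact_Icc
  filter_upwards [hK.eventually_forall_of_forall_eventually
    (P := fun p a => (∀ i, Summable (taylorTerm (v i) (pencil p (companionMatrix a)))) ∧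
        (companionResidue v (p, a) = 0 ↔ a = f p)) fun a _ => hf a] with p hp A hA hAR
  obtain ⟨h1, h2⟩ := hp (charCoeff A) fun i _ => abs_le.1 (hAR i)
  refine ⟨fun i => summable_taylorTerm_pencil (h1 i), ?_⟩
  rw [← companionTransfer_rMatrix h1, companionTransfer_eq_zero_iff hA, ← funext_iff, ← h2,
    companionResidue_eq_zero_iff]

end MatrixAnalytic

/-! ### Evolution of the characteristic polynomial along a solution -/

section NijenhuisCharpoly

open Matrix
open scoped Matrix.Norms.Operator

variable {n : ℕ}

theorem TransportAt.of_hasFDerivAt {𝔸 : Type*} [NormedRing 𝔸] [NormedAlgebra ℝ 𝔸]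
    {C Z : ℝ × ℝ → 𝔸} {p : ℝ × ℝ} {Z' : ℝ × ℝ →L[ℝ] 𝔸} (h : HasFDerivAt Z Z' p)
    (h' : Z' (1, 0) = C p * Z' (0, 1)) : TransportAt C Z p :=
  ⟨h.differentiableAt, by rw [h.fderiv, h']⟩

/-- Jacobi's formula for the derivative of a determinant. -/
theorem hasDerivAt_matrix_det {N : ℝ → Matrix (Fin n) (Fin n) ℝ} {N' : Matrix (Fin n) (Fin n) ℝ}
    {s : ℝ} (h : ∀ i j, HasDerivAt (fun s => N s i j) (N' i j) s) :
    HasDerivAt (fun s => (N s).det) (((N s).adjugate * N').trace) s := by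
  have h1 : HasDerivAt (fun s => ∑ σ : Equiv.Perm (Fin n),
      ((Equiv.Perm.sign σ : ℤ) : ℝ) * ∏ i, N s (σ i) i)
      (∑ σ : Equiv.Perm (Fin n), ((Equiv.Perm.sign σ : ℤ) : ℝ) *
        ∑ i, (∏ j ∈ Finset.univ.erase i, N s (σ j) j) • N' (σ i) i) s :=
    HasDerivAt.fun_sum fun σ _ =>
      (HasDerivAt.fun_finsetProd fun i _ => h (σ i) i).const_mul _
  simp only [← det_apply'] at h1
  convert h1 using 1
  have htr : ((N s).adjugate * N').trace =
      ∑ i, ((N s).updateCol i fun k => N' k i).det := by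
    refine Finset.sum_congr rfl fun i _ => ?_
    rw [← cramer_apply, cramer_eq_adjugate_mulVec]
    rfl
  simp only [htr, det_apply', Finset.mul_sum]
  rw [Finset.sum_comm]
  refine Finset.sum_congr rfl fun σ _ => Finset.sum_congr rfl fun i _ => ?_
  rw [← Finset.mul_prod_erase Finset.univ _ (Finset.mem_univ i), updateCol_self, smul_eq_mul,
    mul_comm (N' (σ i) i)]
  congr 2
  exact Finset.prod_congr rfl fun j hj => updateCol_ne (Finset.ne_of_mem_erase hj)

/-- Vanishing torsion on constant fields, where `[ξ, η] = 0` and only derivatives of `L` survive. -/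
theorem IsNijenhuisOn.fderiv_mulVec {L : (Fin n → ℝ) → Matrix (Fin n) (Fin n) ℝ}
    {U : Set (Fin n → ℝ)} (hN : IsNijenhuisOn L U) {w : Fin n → ℝ} (hw : w ∈ U)
    (hL : DifferentiableAt ℝ L w) (ξ η : Fin n → ℝ) :
    fderiv ℝ L w (L w *ᵥ ξ) *ᵥ η - L w *ᵥ (fderiv ℝ L w ξ *ᵥ η) =
      fderiv ℝ L w (L w *ᵥ η) *ᵥ ξ - L w *ᵥ (fderiv ℝ L w η *ᵥ ξ) := by
  have hd : ∀ ξ η, fderiv ℝ (fun z => L z *ᵥ ξ) w η = fderiv ℝ L w η *ᵥ ξ := by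
    intro ξ η
    let ℓ : Matrix (Fin n) (Fin n) ℝ →L[ℝ] (Fin n → ℝ) :=
      ((Matrix.mulVecBilin ℝ ℝ).flip ξ).toContinuousLinearMap
    have h1 : HasFDerivAt (fun z => L z *ᵥ ξ) (ℓ.comp (fderiv ℝ L w)) w :=
      ℓ.hasFDerivAt.comp w hL.hasFDerivAt
    rw [h1.fderiv]
    rfl
  have h := hN (fun _ => ξ) (fun _ => η) contDiffOn_const contDiffOn_const w hw
  simp only [nijenhuisTorsion, VectorField.lieBracket, hd, fderiv_fun_const, Pi.zero_apply,
    _root_.zero_apply, sub_zero, zero_sub, mulVec_zero, mulVec_neg] at h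
  rw [← sub_eq_zero]
  rw [← h]
  abel

/-- With `B η = dL(η) ξ`, the Nijenhuis identity says `dL(Lξ) - L dL(ξ) = BL - LB`. The trace of
this commutator against `K` vanishes because `K` commutes with `L`. -/
theorem IsNijenhuisOn.trace_mul_fderiv {L : (Fin n → ℝ) → Matrix (Fin n) (Fin n) ℝ}
    {U : Set (Fin n → ℝ)} (hN : IsNijenhuisOn L U) {w : Fin n → ℝ} (hw : w ∈ U)
    (hL : DifferentiableAt ℝ L w) {K : Matrix (Fin n) (Fin n) ℝ} (hK : Commute K (L w))
    (ξ : Fin n → ℝ) :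
    (K * fderiv ℝ L w (L w *ᵥ ξ)).trace = (K * L w * fderiv ℝ L w ξ).trace := by
  let B : Matrix (Fin n) (Fin n) ℝ :=
    LinearMap.toMatrix' ((Matrix.mulVecBilin ℝ ℝ).flip ξ ∘ₗ (fderiv ℝ L w : (Fin n → ℝ) →ₗ[ℝ] _))
  have hB : ∀ η, B *ᵥ η = fderiv ℝ L w η *ᵥ ξ := fun η => LinearMap.toMatrix'_mulVec _ _
  have h : fderiv ℝ L w (L w *ᵥ ξ) - L w * fderiv ℝ L w ξ = B * L w - L w * B := by
    refine Matrix.ext_of_mulVec_single fun j => ?_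
    simp only [sub_mulVec, ← mulVec_mulVec, hB]
    exact hN.fderiv_mulVec hw hL ξ _
  have h2 : fderiv ℝ L w (L w *ᵥ ξ) = L w * fderiv ℝ L w ξ + (B * L w - L w * B) := by
    rw [← h]; abel
  rw [h2, mul_add, trace_add, mul_sub, trace_sub, ← mul_assoc K (L w) B, hK.eq,
    trace_mul_comm K (B * L w), mul_assoc B, trace_mul_comm B, ← hK.eq, sub_self, add_zero,
    mul_assoc]

theorem det_smul_one_sub_eq (A : Matrix (Fin n) (Fin n) ℝ) (c : ℝ) :
    (c • (1 : Matrix (Fin n) (Fin n) ℝ) - A).det =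
      c ^ n - ∑ i : Fin n, charCoeff A i * c ^ (n - 1 - (i : ℕ)) := by
  have h : A.charpoly.eval c = (c • (1 : Matrix (Fin n) (Fin n) ℝ) - A).det := by
    rw [Matrix.eval_charpoly, Matrix.scalar_apply, ← Matrix.smul_one_eq_diagonal]
  rw [← h, charpoly_eq_sub_sum_charCoeff]
  simp [Polynomial.eval_finsetSum]

theorem eq_of_sum_mul_pow_eq {w z : Fin n → ℝ}
    (h : ∀ c : ℝ, ∑ k, w k * c ^ (k : ℕ) = ∑ k, z k * c ^ (k : ℕ)) : w = z := by
  have hp : ∑ k, Polynomial.C (w k) * Polynomial.X ^ (k : ℕ) =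
      ∑ k, Polynomial.C (z k) * Polynomial.X ^ (k : ℕ) := by
    refine Polynomial.funext fun c => ?_
    simpa [Polynomial.eval_finsetSum] using h c
  have hc : ∀ (y : Fin n → ℝ) (j : Fin n),
      (∑ k, Polynomial.C (y k) * Polynomial.X ^ (k : ℕ)).coeff j = y j := by
    intro y j
    rw [Polynomial.finsetSum_coeff, Finset.sum_eq_single j]
    · simp
    · intro k _ hk
      rw [Polynomial.coeff_C_mul_X_pow, if_neg fun h => hk (Fin.ext h.symm)]
    · simp
  funext j
  rw [← hc w j, hp, hc z j]

/-- Only the last column of the companion matrix varies, so the matrix equation is equivalent to its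
last column. -/
theorem transportAt_companionMatrix {s : ℝ × ℝ → Fin n → ℝ} {p : ℝ × ℝ}
    (hs : DifferentiableAt ℝ s p)
    (h : (fun i : Fin n => fderiv ℝ s p (1, 0) i.rev) =
      companionMatrix (s p) *ᵥ fun i : Fin n => fderiv ℝ s p (0, 1) i.rev) :
    TransportAt (fun q => companionMatrix (s q)) (fun q => companionMatrix (s q)) p := by
  let T : (Fin n → ℝ) →ₗ[ℝ] Matrix (Fin n) (Fin n) ℝ :=
    { toFun := fun a => Matrix.of fun i j => if (j : ℕ) + 1 = n then a i.rev else 0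
      map_add' := fun a b => by ext i j; by_cases hj : (j : ℕ) + 1 = n <;> simp [hj]
      map_smul' := fun c a => by ext i j; by_cases hj : (j : ℕ) + 1 = n <;> simp [hj] }
  have hT : ∀ a i j, T a i j = if (j : ℕ) + 1 = n then a i.rev else 0 := fun _ _ _ => rfl
  have hC : ∀ a, companionMatrix a = T a + companionMatrix 0 := by
    intro a
    ext i j
    rw [Matrix.add_apply, hT]
    by_cases hj : (j : ℕ) + 1 = n <;> simp [companionMatrix, hj]
  have hd : HasFDerivAt (fun q => companionMatrix (s q))
      (T.toContinuousLinearMap.comp (fderiv ℝ s p)) p := by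
    have h1 : (fun q => companionMatrix (s q)) = fun q => T (s q) + companionMatrix 0 :=
      funext fun q => hC (s q)
    rw [h1]
    exact (T.toContinuousLinearMap.hasFDerivAt.comp p hs.hasFDerivAt).add_const _
  refine TransportAt.of_hasFDerivAt hd ?_
  change T (fderiv ℝ s p (1, 0)) = companionMatrix (s p) * T (fderiv ℝ s p (0, 1))
  ext i j
  rw [hT, mul_apply]
  by_cases hj : (j : ℕ) + 1 = n
  · have h1 := congrFun h i
    simp only [mulVec, dotProduct] at h1
    simpa [hT, hj] using h1
  · simp [hT, hj]

variable [NeZero n]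

theorem charCoeff_zero (A : Matrix (Fin n) (Fin n) ℝ) : charCoeff A 0 = A.trace := by
  rw [Matrix.trace_eq_neg_charpoly_coeff]
  simp [charCoeff]

/-- The companion matrix is multiplication by `λ` modulo its polynomial; the subtracted term is the
reduction by the top coefficient of `w`. -/
theorem sum_companionMatrix_mulVec_mul_pow (a w : Fin n → ℝ) (c : ℝ) :
    ∑ k, (companionMatrix a *ᵥ w) k * c ^ (k : ℕ) =
      c * ∑ k, w k * c ^ (k : ℕ) -
        (c ^ n - ∑ i : Fin n, a i * c ^ (n - 1 - (i : ℕ))) * w (Fin.rev 0) := by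
  let P : (Fin n → ℝ) →ₗ[ℝ] ℝ := Fintype.linearCombination ℝ fun k : Fin n => c ^ (k : ℕ)
  have h : P ∘ₗ (companionMatrix a).mulVecLin = c • P -
      (c ^ n - ∑ i : Fin n, a i * c ^ (n - 1 - (i : ℕ))) • LinearMap.proj (Fin.rev 0) := by
    refine LinearMap.pi_ext fun j x => ?_
    have hx : (Pi.single j x : Fin n → ℝ) = x • Pi.single j 1 := by
      rw [← Pi.single_smul, smul_eq_mul, mul_one]
    rw [hx, map_smul, map_smul]
    congr 1
    simp only [LinearMap.comp_apply, mulVecLin_apply, LinearMap.sub_apply, LinearMap.smul_apply,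
      LinearMap.proj_apply, P, Fintype.linearCombination_apply_single, smul_eq_mul]
    rcases (Nat.succ_le_of_lt j.is_lt).lt_or_eq with hj | hj
    · have hne : (Fin.rev 0 : Fin n) ≠ j := by
        intro h
        have := congrArg Fin.val h
        rw [Fin.val_rev_eq_sub] at this
        simp at this
        omega
      rw [companionMatrix_mulVec_single_of_lt _ hj, Fintype.linearCombination_apply_single,
        Pi.single_eq_of_ne hne]
      simp [pow_succ']
    · have hj' : (j : ℕ) + 1 = n := hj
      have hje : (Fin.rev 0 : Fin n) = j := by
        apply Fin.ext
        rw [Fin.val_rev_eq_sub]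
        simp
        omega
      have hpow : c * c ^ (j : ℕ) = c ^ n := by rw [← pow_succ', hj']
      rw [companionMatrix_mulVec_single_last _ hj', Fintype.linearCombination_apply, hje,
        Pi.single_eq_same, one_mul, mul_one, hpow, sub_sub_cancel, ← Equiv.sum_comp Fin.revPerm]
      refine Finset.sum_congr rfl fun i _ => ?_
      simp [Fin.val_rev_eq_sub, -Fin.val_rev]
  simpa [P, Fintype.linearCombination_apply] using LinearMap.congr_fun h w

/-- If `u_t = L(u) u_x` at `p`, then `χ_t = λ χ_x + χ (tr L(u))_x` for `χ = det (λ Id - L(u))`,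
that is, the companion matrix `C` of `χ` satisfies `C_t = C C_x`. -/
theorem IsNijenhuisOn.transportAt_charCoeff {L : (Fin n → ℝ) → Matrix (Fin n) (Fin n) ℝ}
    {U : Set (Fin n → ℝ)} (hN : IsNijenhuisOn L U) {u : ℝ × ℝ → Fin n → ℝ} {p : ℝ × ℝ}
    (hp : u p ∈ U) (hL : ∀ i j, AnalyticAt ℝ (fun w => L w i j) (u p))
    (hu : AnalyticAt ℝ u p) (heq : fderiv ℝ u p (1, 0) = L (u p) *ᵥ fderiv ℝ u p (0, 1)) :
    TransportAt (fun q => companionMatrix (charCoeff (L (u q))))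
      (fun q => companionMatrix (charCoeff (L (u q)))) p := by
  have hLd : DifferentiableAt ℝ L (u p) := (analyticAt_matrix hL).differentiableAt
  have hG : HasFDerivAt (fun q => L (u q)) ((fderiv ℝ L (u p)).comp (fderiv ℝ u p)) p :=
    hLd.hasFDerivAt.comp p hu.differentiableAt.hasFDerivAt
  have hs : AnalyticAt ℝ (fun q => charCoeff (L (u q))) p :=
    analyticAt_charCoeff fun i j => AnalyticAt.comp (g := fun w => L w i j) (hL i j) hu
  set s : ℝ × ℝ → Fin n → ℝ := fun q => charCoeff (L (u q)) with hsdef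
  have hline : ∀ d : ℝ × ℝ, HasDerivAt (fun τ : ℝ => p + τ • d) d 0 := by
    intro d
    simpa using ((hasDerivAt_id (0 : ℝ)).smul_const d).const_add p
  have hp0 : ∀ d : ℝ × ℝ, p + (0 : ℝ) • d = p := fun d => by simp
  have hsd : ∀ (d : ℝ × ℝ) (i : Fin n),
      HasDerivAt (fun τ : ℝ => s (p + τ • d) i) (fderiv ℝ s p d i) 0 := by
    intro d i
    have h1 : HasFDerivAt s (fderiv ℝ s p) (p + (0 : ℝ) • d) := by
      rw [hp0]; exact hs.differentiableAt.hasFDerivAt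
    exact hasDerivAt_pi.1 (h1.comp_hasDerivAt (0 : ℝ) (hline d)) i
  have hGd : ∀ (d : ℝ × ℝ) (i j : Fin n), HasDerivAt (fun τ : ℝ => L (u (p + τ • d)) i j)
      (fderiv ℝ L (u p) (fderiv ℝ u p d) i j) 0 := by
    intro d i j
    have h1 : HasFDerivAt (fun q => L (u q)) ((fderiv ℝ L (u p)).comp (fderiv ℝ u p))
        (p + (0 : ℝ) • d) := by
      rw [hp0]; exact hG
    have h2 := h1.comp_hasDerivAt (0 : ℝ) (hline d)
    exact (Matrix.entryLinearMap ℝ ℝ i j).toContinuousLinearMap.hasFDerivAt.comp_hasDerivAt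
      (0 : ℝ) h2
  -- Jacobi's formula for `det (c Id - L(u))`; both sides are minus its derivative in direction `d`.
  have hchi : ∀ (c : ℝ) (d : ℝ × ℝ),
      ((c • (1 : Matrix (Fin n) (Fin n) ℝ) - L (u p)).adjugate *
        fderiv ℝ L (u p) (fderiv ℝ u p d)).trace =
        ∑ i : Fin n, fderiv ℝ s p d i * c ^ (n - 1 - (i : ℕ)) := by
    intro c d
    have h1 := hasDerivAt_matrix_det (N := fun τ : ℝ =>
        c • (1 : Matrix (Fin n) (Fin n) ℝ) - L (u (p + τ • d)))
      (N' := -fderiv ℝ L (u p) (fderiv ℝ u p d)) (s := 0) (fun i j => by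
        simpa using (hGd d i j).const_sub ((c • (1 : Matrix (Fin n) (Fin n) ℝ)) i j))
    have h2 : HasDerivAt (fun τ : ℝ => c ^ n - ∑ i : Fin n, s (p + τ • d) i *
        c ^ (n - 1 - (i : ℕ))) (-∑ i : Fin n, fderiv ℝ s p d i * c ^ (n - 1 - (i : ℕ))) 0 :=
      (HasDerivAt.fun_sum fun i _ => (hsd d i).mul_const _).const_sub _
    simp only [det_smul_one_sub_eq] at h1
    have h3 := h1.unique h2
    simpa [hp0] using h3
  have htr : ∀ d : ℝ × ℝ, (fderiv ℝ L (u p) (fderiv ℝ u p d)).trace = fderiv ℝ s p d 0 := by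
    intro d
    have h1 : HasDerivAt (fun τ : ℝ => ∑ i, L (u (p + τ • d)) i i)
        (∑ i, fderiv ℝ L (u p) (fderiv ℝ u p d) i i) 0 :=
      HasDerivAt.fun_sum fun i _ => hGd d i i
    have h2 : (fun τ : ℝ => ∑ i, L (u (p + τ • d)) i i) = fun τ => s (p + τ • d) 0 :=
      funext fun τ => (charCoeff_zero (L (u (p + τ • d)))).symm
    rw [h2] at h1
    exact h1.unique (hsd d 0)
  refine transportAt_companionMatrix hs.differentiableAt (eq_of_sum_mul_pow_eq fun c => ?_)
  have hrev : ∀ d : ℝ × ℝ, ∑ k : Fin n, fderiv ℝ s p d k.rev * c ^ (k : ℕ) =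
      ∑ i : Fin n, fderiv ℝ s p d i * c ^ (n - 1 - (i : ℕ)) := by
    intro d
    rw [← Equiv.sum_comp Fin.revPerm]
    refine Finset.sum_congr rfl fun i _ => ?_
    simp [Fin.val_rev_eq_sub, -Fin.val_rev]
  rw [sum_companionMatrix_mulVec_mul_pow, hrev, hrev, Fin.rev_rev, ← hchi, ← hchi, ← htr,
    ← det_smul_one_sub_eq, heq]
  set A := L (u p) with hA
  set N := c • (1 : Matrix (Fin n) (Fin n) ℝ) - A with hNdef
  have hAN : A = c • 1 - N := by rw [hNdef, sub_sub_cancel]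
  have hK : Commute N.adjugate A := by
    rw [hAN]
    refine ((Commute.one_right _).smul_right c).sub_right ?_
    rw [Commute, SemiconjBy, adjugate_mul, mul_adjugate]
  rw [hN.trace_mul_fderiv hp hLd hK, ← hA]
  -- Multiplying by `A = c Id - N` produces the factor `c` and, through `adj(N) N = det N`, the term
  -- `χ (tr L(u))_x`.
  have h5 : N.adjugate * A = c • N.adjugate - N.det • 1 := by
    rw [hAN, mul_sub, adjugate_mul, mul_smul_comm, mul_one]
  rw [h5, sub_mul, trace_sub, smul_mul_assoc, smul_mul_assoc, one_mul, trace_smul, trace_smul,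
    smul_eq_mul, smul_eq_mul]

end NijenhuisCharpoly

/-! ### Vanishing of `r(C, tC + x Id)` along a solution -/

section Solution

open Matrix
open scoped Matrix.Norms.Operator

variable {n : ℕ}

theorem IsLocalSolution.eventually_fderiv {L : (Fin n → ℝ) → Matrix (Fin n) (Fin n) ℝ}
    {u₀ : ℝ → Fin n → ℝ} {u : ℝ × ℝ → Fin n → ℝ} (hu : IsLocalSolution L u₀ u) :
    ∀ᶠ p : ℝ × ℝ in 𝓝 (0, 0), AnalyticAt ℝ u p ∧
      fderiv ℝ u p (1, 0) = L (u p) *ᵥ fderiv ℝ u p (0, 1) := by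
  filter_upwards [hu.analytic.eventually_analyticAt, hu.equation] with p hp heq
  refine ⟨hp, ?_⟩
  have h1 : HasDerivAt (fun t => u (t, p.2)) (fderiv ℝ u p (1, 0)) p.1 :=
    hp.differentiableAt.hasFDerivAt.comp_hasDerivAt (f := fun t : ℝ => (t, p.2)) p.1
      ((hasDerivAt_id p.1).prodMk (hasDerivAt_const p.1 p.2))
  have h2 : HasDerivAt (fun x => u (p.1, x)) (fderiv ℝ u p (0, 1)) p.2 :=
    hp.differentiableAt.hasFDerivAt.comp_hasDerivAt (f := fun x : ℝ => (p.1, x)) p.2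
      ((hasDerivAt_const p.2 p.1).prodMk (hasDerivAt_id p.2))
  rwa [h1.deriv, h2.deriv] at heq

/-- Along a solution, the companion matrix `C` of the characteristic coefficients of `L(u)`
satisfies `r(C, t C + x Id) = 0`. -/
theorem IsLocalSolution.eventually_rMatrix_eq_zero [NeZero n] {U : Set (Fin n → ℝ)}
    (hU : IsOpen U) {L : (Fin n → ℝ) → Matrix (Fin n) (Fin n) ℝ}
    (hL : ∀ i j, AnalyticOnNhd ℝ (fun u => L u i j) U) (hN : IsNijenhuisOn L U)
    {u₀ : ℝ → Fin n → ℝ} (hu₀U : u₀ 0 ∈ U) {v : Fin n → ℝ → ℝ}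
    (hv : ∀ i x, v i x = charCoeff (L (u₀ x)) i) (hva : ∀ i, AnalyticAt ℝ (v i) 0)
    {u : ℝ × ℝ → Fin n → ℝ} (hu : IsLocalSolution L u₀ u) :
    ∀ᶠ p : ℝ × ℝ in 𝓝 (0, 0), rMatrix v (companionMatrix (charCoeff (L (u p))))
      (pencil p (companionMatrix (charCoeff (L (u p))))) = 0 := by
  have hu0 : u (0, 0) ∈ U := by rw [hu.initial.self_of_nhds]; exact hu₀U
  set C : ℝ × ℝ → Matrix (Fin n) (Fin n) ℝ := fun p => companionMatrix (charCoeff (L (u p)))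
  set Y : ℝ × ℝ → Matrix (Fin n) (Fin n) ℝ := fun p => rMatrix v (C p) (pencil p (C p))
  have hCa : AnalyticAt ℝ C (0, 0) := analyticAt_companionMatrix (analyticAt_charCoeff fun i j =>
    AnalyticAt.comp (g := fun w => L w i j) (hL i j _ hu0) hu.analytic)
  have hYa : AnalyticAt ℝ Y (0, 0) := analyticAt_rMatrix_pencil hva analyticAt_id rfl hCa
  choose r hr _ hrT hrx using fun i => exists_matrixFun_bound (n := n) (hva i)
  have hsmall : ∀ᶠ p : ℝ × ℝ in 𝓝 (0, 0), ∀ i, ‖pencil p (C p)‖ < r i := by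
    refine eventually_all.2 fun i => ?_
    refine (analyticAt_pencil analyticAt_id hCa).continuousAt.norm.eventually_lt
      continuousAt_const ?_
    simpa only [id, pencil_zero, norm_zero] using hr i
  have hCT : ∀ᶠ p : ℝ × ℝ in 𝓝 (0, 0), TransportAt C C p := by
    filter_upwards [hu.eventually_fderiv,
      hu.analytic.continuousAt.preimage_mem_nhds (hU.mem_nhds hu0)] with p hp hpU
    exact hN.transportAt_charCoeff hpU (fun i j => hL i j _ hpU) hp.1 hp.2
  have hYT : ∀ᶠ p : ℝ × ℝ in 𝓝 (0, 0), TransportAt C Y p := by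
    filter_upwards [hCT, hsmall] with p hp hps
    exact (hp.pow n).sub (TransportAt.sum fun i _ => (hrT i C p hp (hps i)).mul (hp.pow _)
      (commute_matrixFun_pencil (v i) p (C p)))
  have hinit : ∀ᶠ x : ℝ in 𝓝 0, Y (0, x) = 0 := by
    have hx : ∀ᶠ x : ℝ in 𝓝 0, ∀ i, |x| < r i := by
      refine eventually_all.2 fun i => ?_
      refine continuous_abs.continuousAt.eventually_lt continuousAt_const ?_
      simpa using hr i
    filter_upwards [hu.initial, hx] with x hx hxr
    have h1 : charCoeff (L (u (0, x))) = fun i => v i x := by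
      funext i; rw [hx, hv]
    have h2 : pencil ((0 : ℝ), x) (C (0, x)) = x • 1 := by simp [pencil]
    simp only [Y, h2]
    rw [rMatrix_smul_one fun i => hrx i x (hxr i), h1]
    simp
  have hinit' : ∀ᶠ p : ℝ × ℝ in 𝓝 (0, 0), Y (0, p.2) = 0 :=
    (continuous_snd.tendsto ((0 : ℝ), (0 : ℝ))).eventually hinit
  obtain ⟨ε, hε, hball⟩ := Metric.eventually_nhds_iff_ball.1
    (((hCa.eventually_analyticAt.and hYa.eventually_analyticAt).and hYT).and hinit')
  filter_upwards [Metric.ball_mem_nhds _ hε] with p hp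
  exact eq_zero_of_transport (fun q hq => (hball q hq).1.1.1) (fun q hq => (hball q hq).1.1.2)
    (fun q hq => (hball q hq).1.2.2) (fun x hx => (hball _ hx).2) p hp

end Solution

theorem mainTheorem10 (n : ℕ) (U : Set (Fin n → ℝ)) (hU : IsOpen U)
    (L : (Fin n → ℝ) → Matrix (Fin n) (Fin n) ℝ)
    (hL : ∀ i j, AnalyticOnNhd ℝ (fun u => L u i j) U)
    (hN : IsNijenhuisOn L U)
    (u₀ : ℝ → Fin n → ℝ) (hu₀ : AnalyticAt ℝ u₀ 0) (hu₀U : u₀ 0 ∈ U)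
    (v : Fin n → ℝ → ℝ) (hv : ∀ i x, v i x = charCoeff (L (u₀ x)) i) :
    ∃ f : ℝ × ℝ → Fin n → ℝ,
      AnalyticAt ℝ f (0, 0) ∧
      (∀ R : ℝ, ∀ᶠ p : ℝ × ℝ in 𝓝 (0, 0), ∀ A : Matrix (Fin n) (Fin n) ℝ,
        IsGlRegular A → (∀ i, |charCoeff A i| ≤ R) →
          (∀ i, Summable (taylorTerm (v i) (pencil p A))) ∧
          (rMatrix v A (pencil p A) = 0 ↔ ∀ i, charCoeff A i = f p i)) ∧
      (∀ u : ℝ × ℝ → Fin n → ℝ, IsLocalSolution L u₀ u →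
        ∀ᶠ p : ℝ × ℝ in 𝓝 (0, 0), ∀ i, charCoeff (L (u p)) i = f p i) := by
  -- For `n = 0` there is no cyclic vector `e₀`, and every assertion is trivial.
  rcases Nat.eq_zero_or_pos n with rfl | hn
  · exact ⟨fun _ => 0, analyticAt_const, fun R => Eventually.of_forall fun p A _ _ =>
      ⟨fun i => i.elim0, fun _ i => i.elim0, fun _ => Subsingleton.elim _ _⟩,
      fun u _ => Eventually.of_forall fun p i => i.elim0⟩
  have : NeZero n := ⟨hn.ne'⟩
  have hva : ∀ i, AnalyticAt ℝ (v i) 0 := by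
    intro i
    have h1 : AnalyticAt ℝ (fun x => charCoeff (L (u₀ x))) 0 := analyticAt_charCoeff fun j k =>
      AnalyticAt.comp (g := fun w => L w j k) (hL j k _ hu₀U) hu₀
    have h2 : v i = fun x => charCoeff (L (u₀ x)) i := funext (hv i)
    rw [h2]
    exact analyticAt_pi_iff.1 h1 i
  obtain ⟨f, hfa, hf⟩ := exists_companionResidue_zero hva
  refine ⟨f, hfa, eventually_rMatrix_pencil_eq_zero_iff hf, fun u hu => ?_⟩
  have hu0 : u (0, 0) ∈ U := by rw [hu.initial.self_of_nhds]; exact hu₀U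
  have hs : ContinuousAt (fun p => charCoeff (L (u p))) (0, 0) :=
    (analyticAt_charCoeff fun j k =>
      AnalyticAt.comp (g := fun w => L w j k) (hL j k _ hu0) hu.analytic).continuousAt
  -- The matrix `L(u)` need not be `gl`-regular, so the comparison with `f` is made through the
  -- companion matrix, near the coefficients at the origin.
  have hq : Tendsto (fun p : ℝ × ℝ => (p, charCoeff (L (u p)))) (𝓝 (0, 0))
      (𝓝 ((0, 0), charCoeff (L (u (0, 0))))) := continuousAt_id.prodMk hs
  filter_upwards [hq.eventually (hf _),
    hu.eventually_rMatrix_eq_zero hU hL hN hu₀U hv hva] with p hp hr i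
  refine congrFun (hp.2.1 (companionResidue_eq_zero_iff.2 ?_)) i
  rw [hr, Matrix.zero_mulVec]
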